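/- Fix a cuspidal representation $\rho$ of a general linear group over a non-Archimedean local field. A segment $[a,b]_\rho$ is given by integers $a\le b$, and we write $a(\Delta)=a$, $b(\Delta)=b$ for $\Delta=[a,b]_\rho$ (also $[a,a-1]_\rho=\emptyset$). A multisegment is a finite multiset of (non-empty) segments; $+$ and $-$ denote multiset sum and difference, and empty segments are dropped. Zelevinsky order. For segments $\Delta=[a,b]_\rho$, $\Delta'=[a',b']_\rho$ write $\Delta<\Delta'$ if $a<a'\le b+1\le b'$; $\Delta,\Delta'$ are linked if $\Delta<\Delta'$ or $\Delta'<\Delta$. An elementary intersection-union process replaces two members $\Delta<\Delta'$ of a multisegment by $[a,b']_\rho$ and $[a',b]_\rho$ (the latter is dropped if it is empty). Write $\mathfrak n'\le_Z\mathfrak n$ if $\mathfrak n'$ is obtained from $\mathfrak n$ by finitely many (possibly zero) such processes. Removal process. A segment $\Delta=[a,b]_\rho$ is admissible to a multisegment $\mathfrak h$ if $\mathfrak h$ contains some $[a,c]_\rho$ with $c\ge b$. In that case let $\Delta_1=[a_1,b_1]_\rho$ be the shortest such segment and, recursively, let $\Delta_i=[a_i,b_i]_\rho$ be the segment of $\mathfrak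 h$ with $a_{i-1}<a_i\le b\le b_i<b_{i-1}$ for which $(a_i,b_i)$ is lexicographically smallest, as long as there is one; let $\Delta_1,\dots,\Delta_r$ be the resulting sequence. Set $$\mathfrak r(\Delta,\mathfrak h)=\mathfrak h-\sum_{i=1}^r\Delta_i+\sum_{i=1}^{r-1}[a_{i+1},b_i]_\rho+[b+1,b_r]_\rho .$$ If $\Delta$ is not admissible to $\mathfrak h$, set $\mathfrak r(\Delta,\mathfrak h)=\infty$; also $\mathfrak r(\Delta,\infty)=\infty$. For a multisegment $\mathfrak n$ with segments $\Delta_1,\dots,\Delta_k$ listed in the lexicographic order of $(a(\Delta_i),b(\Delta_i))$ (which is an ascending order: for $i<j$, $\Delta_i$ and $\Delta_j$ are unlinked or $a(\Delta_i)<a(\Delta_j)$), set $\mathfrak r(\mathfrak n,\mathfrak h)=\mathfrak r(\Delta_k,\dots,\mathfrak r(\Delta_1,\mathfrak h)\dots)$. We say that $\mathfrak n$ is minimal to $\mathfrak h$ if $\mathfrak r(\mathfrak n,\mathfrak h)\ne\infty$ and there is no multisegment $\mathfrak n'\ne\mathfrak n$ with $\mathfrak n'\le_Z\mathfrak n$ and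 $\mathfrak r(\mathfrak n',\mathfrak h)=\mathfrak r(\mathfrak n,\mathfrak h)$. The invariant $\eta$. For a segment $\Delta=[a,b]_\rho$ and $a\le c\le b$ let $\varepsilon_{[c,b]_\rho}(\mathfrak h)$ be the number of segments $[c,d]_\rho$ of $\mathfrak h$ (with multiplicity) with $d\ge b$, and let $\eta_\Delta(\mathfrak h)=(\varepsilon_{[a,b]_\rho}(\mathfrak h),\varepsilon_{[a+1,b]_\rho}(\mathfrak h),\dots,\varepsilon_{[b,b]_\rho}(\mathfrak h))$. Proposition. Let $\mathfrak h$ be a multisegment and let $\mathfrak n$ be a multisegment minimal to $\mathfrak h$. Let $\Delta=[a,b]_\rho$ be a segment such that $a(\Delta')<a$ and $b(\Delta')<b$ for every $\Delta'\in\mathfrak n$. Then $\mathfrak n+\Delta$ is minimal to $\mathfrak h$ if and only if $\Delta$ is admissible to $\mathfrak h$ and $$\eta_\Delta(\mathfrak r(\mathfrak n,\mathfrak h))=\eta_\Delta(\mathfrak h).$$ -/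

import Mathlib

namespace Multisegment

/-- A non-empty segment `[a,b]_ρ`. The cuspidal representation `ρ` is fixed, so the segment is
determined by its integer end points `a ≤ b`. -/
@[ext]
structure Seg where
  a : ℤ
  b : ℤ
  le : a ≤ b

namespace Seg

/-- The order `≼^L`: first compare the starts, then the ends. -/
instance : LinearOrder Seg :=
  LinearOrder.lift' (fun s => toLex (s.a, s.b)) (by
    intro s t h
    have h' : (s.a, s.b) = (t.a, t.b) := toLex.injective h
    rw [Prod.mk.injEq] at h'
    exact Seg.ext h'.1 h'.2)

theorem le_iff (s t : Seg) : s ≤ t ↔ s.a < t.a ∨ (s.a = t.a ∧ s.b ≤ t.b) :=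
  Prod.Lex.toLex_le_toLex (x := (s.a, s.b)) (y := (t.a, t.b))

theorem lt_iff (s t : Seg) : s < t ↔ s.a < t.a ∨ (s.a = t.a ∧ s.b < t.b) :=
  Prod.Lex.toLex_lt_toLex (x := (s.a, s.b)) (y := (t.a, t.b))

/-- `s.Precedes t` : the segments are linked and `s < t` in the sense of Zelevinsky,
i.e. `a(s) < a(t) ≤ b(s) + 1 ≤ b(t)`. -/
def Precedes (s t : Seg) : Prop := s.a < t.a ∧ t.a ≤ s.b + 1 ∧ s.b + 1 ≤ t.b

def Linked (s t : Seg) : Prop := s.Precedes t ∨ t.Precedes s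

end Seg

/-- Multisegments: finite multisets of non-empty segments. -/
abbrev Mult := Multiset Seg

/-- The multisegment `{[x,y]_ρ}`, where an empty segment is dropped. -/
def ofEnds (x y : ℤ) : Mult := if h : x ≤ y then {⟨x, y, h⟩} else 0

/-! ### The Zelevinsky order -/

/-- `n` is obtained from `m` by one elementary intersection-union process: a pair of linked
segments `s < t` of `m` is replaced by `s ∪ t = [a(s), b(t)]` and `s ∩ t = [a(t), b(s)]`. -/
def ElemStep (m n : Mult) : Prop :=
  ∃ (s t : Seg) (m₀ : Mult), s.Precedes t ∧ m = m₀ + {s} + {t} ∧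
    n = m₀ + ofEnds s.a t.b + ofEnds t.a s.b

/-- `n ≤_Z m`. -/
def ZLe (n m : Mult) : Prop := Relation.ReflTransGen ElemStep m n

/-! ### The removal process -/

/-- `Δ = [a,b]` is admissible to `h`: some `[a,c]` with `c ≥ b` lies in `h`. -/
def Admissible (Δ : Seg) (h : Mult) : Prop := ∃ s ∈ h, s.a = Δ.a ∧ Δ.b ≤ s.b

/-- The `≺^L`-minimal segment of a multisegment, if there is one. -/
def lexMin (m : Mult) : Option Seg := (m.sort (· ≤ ·)).head?

theorem mem_of_lexMin {m : Mult} {s : Seg} (hs : lexMin m = some s) : s ∈ m :=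
  (Multiset.mem_sort (· ≤ ·)).1 (List.mem_of_head? hs)

theorem lexMin_le {m : Mult} {s t : Seg} (hs : lexMin m = some s) (ht : t ∈ m) : s ≤ t := by
  have hp := Multiset.pairwise_sort m (· ≤ ·)
  have ht' : t ∈ m.sort (· ≤ ·) := (Multiset.mem_sort (· ≤ ·)).2 ht
  unfold lexMin at hs
  cases hl : m.sort (· ≤ ·) with
  | nil => simp [hl] at hs
  | cons x l =>
    rw [hl] at hs hp ht'
    obtain rfl : x = s := by simpa using hs
    rcases List.mem_cons.1 ht' with rfl | h
    · exact le_rfl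
    · exact List.rel_of_pairwise_cons hp h

/-- `Υ(Δ, h)`, the shortest segment `[a,c]` of `h` with `c ≥ b`, where `Δ = [a,b]`. Among segments
with the same start, the shortest one is the `≺^L`-minimal one. -/
def firstSeg (Δ : Seg) (h : Mult) : Option Seg :=
  lexMin (h.filter fun s => s.a = Δ.a ∧ Δ.b ≤ s.b)

/-- The segments of the removal sequence that come after `p`: the next one is the `≺^L`-minimal
`[a',b']` in `h` with `a(p) < a' ≤ b` and `b ≤ b' < b(p)`. -/
def nextSegs (h : Mult) (b : ℤ) (p : Seg) : List Seg :=
  match hs : lexMin (h.filter fun s => (p.a < s.a ∧ s.a ≤ b) ∧ (b ≤ s.b ∧ s.b < p.b)) with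
  | none => []
  | some s => s :: nextSegs h b s
termination_by (b - p.a).toNat
decreasing_by
  have h1 := (Multiset.mem_filter.1 (mem_of_lexMin hs)).2.1
  omega

/-- The removal sequence `Δ₁, …, Δ_r` for `(Δ, h)` (empty if `Δ` is not admissible to `h`). -/
def removalSeq (Δ : Seg) (h : Mult) : List Seg :=
  match firstSeg Δ h with
  | none => []
  | some s => s :: nextSegs h Δ.b s

/-- The truncations of `Δ₁, …, Δ_r`: `[a(Δ_{i+1}), b(Δ_i)]` for `i < r`,
and `[b+1, b(Δ_r)]`, which may be empty, for `i = r`. -/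
def truncations (b : ℤ) : List Seg → Mult
  | [] => 0
  | [s] => ofEnds (b + 1) s.b
  | s :: t :: l => ofEnds t.a s.b + truncations b (t :: l)

open Classical in
/-- `𝔯(Δ, h)`; the value `⊤` is the infinity multisegment. -/
noncomputable def removal (Δ : Seg) : WithTop Mult → WithTop Mult
  | none => ⊤
  | some h =>
    if Admissible Δ h then
      ((h - (removalSeq Δ h : Mult) + truncations Δ.b (removalSeq Δ h) : Mult) : WithTop Mult)
    else ⊤

/-- A sequence of segments in an ascending order. -/
def IsAscending (l : List Seg) : Prop := l.Pairwise fun s t => ¬ s.Linked t ∨ s.a < t.a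

theorem isAscending_sort (n : Mult) : IsAscending (n.sort (· ≤ ·)) := by
  refine (Multiset.pairwise_sort n (· ≤ ·)).imp ?_
  intro s t hst
  rw [Seg.le_iff] at hst
  unfold Seg.Linked Seg.Precedes
  omega

/-- `𝔯(n, h) = 𝔯(Δ_r, …, 𝔯(Δ₁, h)…)`, where `Δ₁, …, Δ_r` are the segments of `n` in the ascending
order with `a(Δ₁) ≤ … ≤ a(Δ_r)` (and `b(Δ_i) ≤ b(Δ_{i+1})` if the starts agree). -/
noncomputable def removalMult (n h : Mult) : WithTop Mult :=
  (n.sort (· ≤ ·)).foldl (fun x Δ => removal Δ x) (h : WithTop Mult)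

/-- `n` is minimal to `h`: `n` is admissible to `h` and it is a `≤_Z`-minimal element of the set of
multisegments `n'` with `𝔯(n', h) = 𝔯(n, h)`. -/
def MinimalTo (n h : Mult) : Prop :=
  removalMult n h ≠ ⊤ ∧
    ∀ n' : Mult, removalMult n' h = removalMult n h → ZLe n' n → n' = n

/-! ### The invariant `η` -/

/-- `ε_Δ(h)`, the number of segments of `h` that contain `Δ` and have the same start as `Δ`. -/
def epsilon (Δ : Seg) (h : Mult) : ℕ :=
  Multiset.card (h.filter fun s => s.a = Δ.a ∧ Δ.b ≤ s.b)

/-- The tuple `η_Δ(h) = (ε_{[a,b]}(h), ε_{[a+1,b]}(h), …, ε_{[b,b]}(h))` for `Δ = [a,b]`, indexed by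
the starts `c ∈ {a, …, b}`. -/
def eta (Δ : Seg) (h : Mult) : Set.Icc Δ.a Δ.b → ℕ :=
  fun c => epsilon ⟨c, Δ.b, c.2.2⟩ h

end Multisegment

/-! Everything is read off quadrant counts. `rk m x y` counts the segments containing `[x,y]` when
`x ≤ y`, and these counts determine `m`. The equation `𝔯(n,h) = k` is equivalent
(`removalMult_eq_iff`) to three conditions on the defect `slack = rk h - rk k - rk n`: it is
nonnegative for `x ≤ y`, vanishes on the diagonal, and vanishes at `(a(s), b(s)+1)` for each `s ∈
k`.

An elementary process on `s < t` in `n` raises `rk n` by one exactly on the rectangle `a(s) ≤ x <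
a(t)`, `b(s) < y ≤ b(t)`. Hence `n` is minimal exactly when the defect has a zero in the rectangle
of every linked pair (`minimalTo_iff`).

Adding `Δ = [a,b]` leaves the defect unchanged in rows `x < a`, so only the rectangles of pairs `(s,
Δ)` are new. All of them contain the corner `(a-1, b)`; conversely, zeros in all of them force a
zero at that corner (`IsRemoval.slack_eq_zero_of_rect`). Finally, `η_Δ(k)` and `η_Δ(h)` differ by
the increments of the defect along column `b`, and their equality is again the vanishing at `(a-1,
b)` (`IsRemoval.eta_eq_iff`). -/

namespace Multisegment

/-! ### Rank functions -/

/-- The number of segments `[a,b]` of `m` with `a ≤ x` and `y ≤ b`. -/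
def rk (m : Mult) (x y : ℤ) : ℤ := (m.countP fun s => s.a ≤ x ∧ y ≤ s.b : ℕ)

@[simp] theorem rk_zero (x y : ℤ) : rk 0 x y = 0 := by simp [rk]

theorem rk_add (m n : Mult) (x y : ℤ) : rk (m + n) x y = rk m x y + rk n x y := by
  simp [rk, Multiset.countP_add]

theorem rk_singleton (s : Seg) (x y : ℤ) :
    rk {s} x y = if s.a ≤ x ∧ y ≤ s.b then 1 else 0 := by
  rw [rk, ← Multiset.cons_zero, Multiset.countP_cons]
  split_ifs <;> simp

theorem rk_cons (s : Seg) (m : Mult) (x y : ℤ) :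
    rk (s ::ₘ m) x y = (if s.a ≤ x ∧ y ≤ s.b then 1 else 0) + rk m x y := by
  rw [← Multiset.singleton_add, rk_add, rk_singleton]

/-- With `x ≤ y`, a dropped empty segment would not have been counted anyway, so no case distinction
survives. -/
theorem rk_ofEnds (u v : ℤ) {x y : ℤ} (hxy : x ≤ y) :
    rk (ofEnds u v) x y = if u ≤ x ∧ y ≤ v then 1 else 0 := by
  unfold ofEnds
  split_ifs with h h1 h1
  · rw [rk_singleton, if_pos h1]
  · rw [rk_singleton, if_neg h1]
  · omega
  · simp

theorem rk_sub {m n : Mult} (hnm : n ≤ m) (x y : ℤ) : rk (m - n) x y = rk m x y - rk n x y := by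
  have := rk_add (m - n) n x y
  rw [tsub_add_cancel_of_le hnm] at this
  omega

theorem rk_mono_left (m : Mult) {x x' : ℤ} (hx : x ≤ x') (y : ℤ) : rk m x y ≤ rk m x' y := by
  induction m using Multiset.induction with
  | empty => simp
  | cons s m ih => rw [rk_cons, rk_cons]; split_ifs <;> omega

theorem rk_eq_zero {m : Mult} {x y : ℤ} (h : ∀ s ∈ m, s.a ≤ x → s.b < y) : rk m x y = 0 := by
  rw [rk, Nat.cast_eq_zero, Multiset.countP_eq_zero]
  intro s hs ⟨h1, h2⟩
  have := h s hs h1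
  omega

theorem rk_pos {m : Mult} {x y : ℤ} {s : Seg} (hs : s ∈ m) (h1 : s.a ≤ x) (h2 : y ≤ s.b) :
    0 < rk m x y := by
  rw [rk, Nat.cast_pos, Multiset.countP_pos]
  exact ⟨s, hs, h1, h2⟩

theorem exists_lt_starts (m : Mult) : ∃ x₀ : ℤ, ∀ s ∈ m, x₀ < s.a := by
  induction m using Multiset.induction with
  | empty => exact ⟨0, by simp⟩
  | cons s m ih =>
    obtain ⟨x, hx⟩ := ih
    refine ⟨min x (s.a - 1), fun t ht => ?_⟩
    rcases Multiset.mem_cons.1 ht with rfl | ht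
    · omega
    · have := hx t ht
      omega

/-- Inclusion-exclusion for quadrants. Its sign and its vanishing drive all later comparisons of
defects. -/
theorem countP_rect (m : Mult) {x₀ x₁ y₀ y₁ : ℤ} (hx : x₀ ≤ x₁) (hy : y₀ ≤ y₁) :
    ((m.countP fun s => (x₀ < s.a ∧ s.a ≤ x₁) ∧ (y₀ ≤ s.b ∧ s.b < y₁) : ℕ) : ℤ) =
      rk m x₁ y₀ - rk m x₁ y₁ - rk m x₀ y₀ + rk m x₀ y₁ := by
  induction m using Multiset.induction with
  | empty => simp
  | cons s m ih =>
    simp only [rk_cons, Multiset.countP_cons, Nat.cast_add]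
    rw [ih]
    push_cast
    split_ifs <;> omega

theorem rect_nonneg (m : Mult) {x₀ x₁ y₀ y₁ : ℤ} (hx : x₀ ≤ x₁) (hy : y₀ ≤ y₁) :
    0 ≤ rk m x₁ y₀ - rk m x₁ y₁ - rk m x₀ y₀ + rk m x₀ y₁ := by
  rw [← countP_rect m hx hy]
  exact Nat.cast_nonneg _

theorem rect_eq_zero {m : Mult} {x₀ x₁ y₀ y₁ : ℤ} (hx : x₀ ≤ x₁) (hy : y₀ ≤ y₁)
    (h : ∀ s ∈ m, ¬((x₀ < s.a ∧ s.a ≤ x₁) ∧ (y₀ ≤ s.b ∧ s.b < y₁))) :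
    rk m x₁ y₀ - rk m x₁ y₁ - rk m x₀ y₀ + rk m x₀ y₁ = 0 := by
  rw [← countP_rect m hx hy, Nat.cast_eq_zero, Multiset.countP_eq_zero]
  exact h

theorem rk_ext {m n : Mult} (h : ∀ x y, x ≤ y → rk m x y = rk n x y) : m = n := by
  ext s
  have key : ∀ k : Mult, ((k.count s : ℕ) : ℤ) =
      rk k s.a s.b - rk k s.a (s.b + 1) - rk k (s.a - 1) s.b + rk k (s.a - 1) (s.b + 1) := by
    intro k
    rw [← countP_rect k (by omega) (by omega), Multiset.count]
    congr 2
    funext t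
    rw [Seg.ext_iff]
    apply propext
    omega
  have hs := s.le
  have h1 := key m
  have h2 := key n
  rw [h _ _ (by omega), h _ _ (by omega), h _ _ (by omega), h _ _ (by omega), ← h2] at h1
  exact_mod_cast h1

/-! ### The rank characterization of the removal process -/

/-- The rank inequalities that characterize `𝔯(n, h) = k`. -/
structure IsRemoval (n h k : Mult) : Prop where
  le : ∀ x y, x ≤ y → rk n x y + rk k x y ≤ rk h x y
  diag : ∀ x, rk n x x + rk k x x = rk h x x
  tight : ∀ s ∈ k, rk n s.a (s.b + 1) + rk k s.a (s.b + 1) = rk h s.a (s.b + 1)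

/-! ### Rank effect of removing a single segment -/

theorem nextSegs_of_none {h : Mult} {b : ℤ} {p : Seg}
    (hs : lexMin (h.filter fun s => (p.a < s.a ∧ s.a ≤ b) ∧ (b ≤ s.b ∧ s.b < p.b)) = none) :
    nextSegs h b p = [] := by
  rw [nextSegs]
  split
  · rfl
  · simp_all

theorem nextSegs_of_some {h : Mult} {b : ℤ} {p q : Seg}
    (hs : lexMin (h.filter fun s => (p.a < s.a ∧ s.a ≤ b) ∧ (b ≤ s.b ∧ s.b < p.b)) = some q) :
    nextSegs h b p = q :: nextSegs h b q := by
  rw [nextSegs]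
  split
  · simp_all
  · simp_all

theorem lexMin_eq_none {m : Mult} : lexMin m = none ↔ m = 0 := by
  unfold lexMin
  rw [List.head?_eq_none_iff]
  constructor
  · intro h
    rw [← Multiset.sort_eq m (· ≤ ·), h]
    rfl
  · rintro rfl
    simp

theorem mem_ofEnds {u v : ℤ} {s : Seg} : s ∈ ofEnds u v ↔ s.a = u ∧ s.b = v := by
  unfold ofEnds
  split_ifs with h
  · rw [Multiset.mem_singleton, Seg.ext_iff]
  · have := s.le
    simp only [Multiset.notMem_zero, false_iff]
    omega

/-- The properties of a removal sequence `l` that starts with `p`. -/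
structure IsRemovalChain (h : Mult) (b : ℤ) (p : Seg) (l : List Seg) : Prop where
  mem : ∀ s ∈ l, s ∈ h ∧ p.a ≤ s.a
  nodup : l.Nodup
  mem_trunc : ∀ s ∈ truncations b l, b ≤ s.b ∧ p.a < s.a ∧
    ∃ s' ∈ h, s'.b = s.b ∧ p.a ≤ s'.a ∧ s'.a < s.a
  rk_lt : ∀ x y, x ≤ y → x < p.a → rk l x y = rk (truncations b l) x y
  rk_gt : ∀ x y, x ≤ y → b < x → rk l x y = rk (truncations b l) x y
  rk_inner : ∀ x y, x ≤ y → p.a ≤ x → y ≤ b → rk l x y = rk (truncations b l) x y + 1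
  rk_le : ∀ x y, x ≤ y → rk (truncations b l) x y ≤ rk l x y
  rk_far : ∀ x y, x ≤ y → p.b < y → rk l x y = rk (truncations b l) x y
  tight : ∀ t ∈ h, p.a < t.a → b ≤ t.b →
    rk l t.a (t.b + 1) = rk (truncations b l) t.a (t.b + 1)
  tight_trunc : ∀ t ∈ truncations b l,
    rk l t.a (t.b + 1) = rk (truncations b l) t.a (t.b + 1)

/-- The chain minus its truncations has as rank function the indicator of a staircase, one strip per
segment. The induction follows the termination measure of `nextSegs`. -/
theorem isRemovalChain_nextSegs {h : Mult} {b : ℤ} (N : ℕ) : ∀ {p : Seg}, (b - p.a).toNat = N →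
    p ∈ h → p.a ≤ b → b ≤ p.b → IsRemovalChain h b p (p :: nextSegs h b p) := by
  induction N using Nat.strong_induction_on with
  | _ N ih =>
  intro p hN hp hpa hpb
  cases hs : lexMin (h.filter fun s => (p.a < s.a ∧ s.a ≤ b) ∧ (b ≤ s.b ∧ s.b < p.b)) with
  | none =>
    rw [nextSegs_of_none hs]
    have hno := Multiset.filter_eq_nil.1 (lexMin_eq_none.1 hs)
    have hrk : ∀ x y, x ≤ y → rk ([p] : List Seg) x y = rk (truncations b [p]) x y +
        if p.a ≤ x ∧ x ≤ b ∧ y ≤ p.b then 1 else 0 := by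
      intro x y hxy
      rw [Multiset.coe_singleton, truncations, rk_singleton, rk_ofEnds _ _ hxy]
      split_ifs <;> omega
    refine ⟨?_, ?_, ?_, ?_, ?_, ?_, ?_, ?_, ?_, ?_⟩
    · intro s hs'
      obtain rfl : s = p := by simpa using hs'
      exact ⟨hp, le_rfl⟩
    · simp
    · intro s hs'
      obtain ⟨h1, h2⟩ := mem_ofEnds.1 hs'
      exact ⟨by omega, by omega, p, hp, by omega, le_rfl, by omega⟩
    · intro x y hxy hx; rw [hrk x y hxy, if_neg (by omega), add_zero]
    · intro x y hxy hx; rw [hrk x y hxy, if_neg (by omega), add_zero]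
    · intro x y hxy hx hy; rw [hrk x y hxy, if_pos (by omega)]
    · intro x y hxy; rw [hrk x y hxy]; split_ifs <;> omega
    · intro x y hxy hy; rw [hrk x y hxy, if_neg (by omega), add_zero]
    · intro t ht h1 h2
      have := hno t ht
      have := t.le
      rw [hrk _ _ (by omega), if_neg (by omega), add_zero]
    · intro t ht
      obtain ⟨h1, h2⟩ := mem_ofEnds.1 ht
      have := t.le
      rw [hrk _ _ (by omega), if_neg (by omega), add_zero]
  | some q =>
    rw [nextSegs_of_some hs]
    obtain ⟨hq, ⟨hq1, hq2⟩, hq3, hq4⟩ := Multiset.mem_filter.1 (mem_of_lexMin hs)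
    have hmin : ∀ t ∈ h, (p.a < t.a ∧ t.a ≤ b) ∧ (b ≤ t.b ∧ t.b < p.b) → q ≤ t :=
      fun t ht h' => lexMin_le hs (Multiset.mem_filter.2 ⟨ht, h'⟩)
    have C := ih (b - q.a).toNat (by omega) rfl hq hq2 hq3
    generalize hl : nextSegs h b q = l at C
    -- Replacing `p` by `[a(q), b(p)]` adds one strip to the staircase.
    have hrk : ∀ x y, x ≤ y → rk ((p :: q :: l : List Seg) : Mult) x y -
        rk (truncations b (p :: q :: l)) x y =
        (rk ((q :: l : List Seg) : Mult) x y - rk (truncations b (q :: l)) x y) +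
        if p.a ≤ x ∧ x < q.a ∧ y ≤ p.b then 1 else 0 := by
      intro x y hxy
      rw [truncations, ← Multiset.cons_coe p, rk_cons, rk_add, rk_ofEnds _ _ hxy]
      split_ifs <;> omega
    have hrow : ∀ y, q.a ≤ y → q.b < y →
        rk ((q :: l : List Seg) : Mult) q.a y = rk (truncations b (q :: l)) q.a y :=
      fun y h1 h2 => C.rk_far _ _ h1 h2
    refine ⟨?_, ?_, ?_, ?_, ?_, ?_, ?_, ?_, ?_, ?_⟩
    · intro s hs'
      rcases List.mem_cons.1 hs' with rfl | hs'
      · exact ⟨hp, le_rfl⟩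
      · have := C.mem s hs'
        exact ⟨this.1, by omega⟩
    · refine List.nodup_cons.2 ⟨fun hm => ?_, C.nodup⟩
      have := (C.mem p hm).2
      omega
    · intro s hs'
      rw [truncations, Multiset.mem_add] at hs'
      rcases hs' with hs' | hs'
      · obtain ⟨h1, h2⟩ := mem_ofEnds.1 hs'
        exact ⟨by omega, by omega, p, hp, by omega, le_rfl, by omega⟩
      · obtain ⟨h1, h2, s', h3, h4, h5, h6⟩ := C.mem_trunc s hs'
        exact ⟨h1, by omega, s', h3, h4, by omega, h6⟩
    · intro x y hxy hx
      have := hrk x y hxy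
      have := C.rk_lt x y hxy (by omega)
      rw [if_neg (by omega)] at *; omega
    · intro x y hxy hx
      have := hrk x y hxy
      have := C.rk_gt x y hxy (by omega)
      rw [if_neg (by omega)] at *; omega
    · intro x y hxy hx hy
      have := hrk x y hxy
      by_cases hxq : x < q.a
      · have := C.rk_lt x y hxy hxq
        rw [if_pos (by omega)] at *; omega
      · have := C.rk_inner x y hxy (by omega) hy
        rw [if_neg (by omega)] at *; omega
    · intro x y hxy
      have := hrk x y hxy
      have := C.rk_le x y hxy
      split_ifs at * <;> omega
    · intro x y hxy hy
      have := hrk x y hxy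
      have := C.rk_far x y hxy (by omega)
      rw [if_neg (by omega)] at *; omega
    · intro t ht h1 h2
      have htle := t.le
      have h3 := hrk t.a (t.b + 1) (by omega)
      by_cases htb : t.a ≤ b
      -- Minimality of `q` gives `b(t) ≥ b(p)` if `t` starts before `q`, and `b(t) ≥ b(q)` if it
      -- starts with `q`; in both cases `(t.a, t.b + 1)` lies above the staircase.
      · have h4 := hmin t ht
        rw [Seg.le_iff] at h4
        rcases lt_trichotomy t.a q.a with h5 | h5 | h5
        · have := C.rk_lt t.a (t.b + 1) (by omega) h5
          rw [if_neg (by omega)] at h3; omega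
        · have := C.rk_far t.a (t.b + 1) (by omega) (by omega)
          rw [if_neg (by omega)] at h3; omega
        · have := C.tight t ht h5 h2
          rw [if_neg (by omega)] at h3; omega
      · have := C.rk_gt t.a (t.b + 1) (by omega) (by omega)
        rw [if_neg (by omega)] at h3; omega
    · intro t ht
      have htle := t.le
      have h3 := hrk t.a (t.b + 1) (by omega)
      rw [truncations, Multiset.mem_add] at ht
      rcases ht with ht | ht
      · obtain ⟨h1, h2⟩ := mem_ofEnds.1 ht
        have := C.rk_far t.a (t.b + 1) (by omega) (by omega)
        rw [if_neg (by omega)] at h3; omega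
      · have := (C.mem_trunc t ht).2.1
        have := C.tight_trunc t ht
        rw [if_neg (by omega)] at h3; omega

theorem removal_eq_top {Δ : Seg} {h : Mult} (hΔ : ¬ Admissible Δ h) :
    removal Δ (h : WithTop Mult) = ⊤ := by
  exact if_neg hΔ

/-- The last two clauses serve iteration: rows left of `Δ` are untouched, and each new segment is a
left truncation of an old one. -/
theorem exists_removal {Δ : Seg} {h : Mult} (hΔ : Admissible Δ h) :
    ∃ k : Mult, removal Δ (h : WithTop Mult) = (k : WithTop Mult) ∧ IsRemoval {Δ} h k ∧
      (∀ x y, x ≤ y → x < Δ.a → rk k x y = rk h x y) ∧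
      ∀ s ∈ k, s ∈ h ∨ ∃ s' ∈ h, s'.b = s.b ∧ Δ.a ≤ s'.a ∧ s'.a < s.a := by
  refine ⟨h - (removalSeq Δ h : Mult) + truncations Δ.b (removalSeq Δ h), ?_, ?_⟩
  · exact if_pos hΔ
  obtain ⟨p, hp⟩ : ∃ p, firstSeg Δ h = some p := by
    rw [← Option.ne_none_iff_exists']
    intro h0
    obtain ⟨s, hs, h1⟩ := hΔ
    exact Multiset.filter_eq_nil.1 (lexMin_eq_none.1 h0) s hs h1
  obtain ⟨hph, hpa, hpb⟩ := Multiset.mem_filter.1 (mem_of_lexMin hp)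
  have hmin : ∀ t ∈ h, t.a = Δ.a → Δ.b ≤ t.b → p.b ≤ t.b := by
    intro t ht h1 h2
    have := lexMin_le hp (Multiset.mem_filter.2 ⟨ht, h1, h2⟩)
    rw [Seg.le_iff] at this
    omega
  have hseq : removalSeq Δ h = p :: nextSegs h Δ.b p := by
    rw [removalSeq, hp]
  have C := isRemovalChain_nextSegs _ rfl hph (hpa.le.trans Δ.le) hpb
  rw [← hseq] at C
  have hle : (removalSeq Δ h : Mult) ≤ h :=
    (Multiset.le_iff_subset (Multiset.coe_nodup.2 C.nodup)).2 fun s hs => (C.mem s hs).1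
  have hrk : ∀ x y, rk (h - (removalSeq Δ h : Mult) + truncations Δ.b (removalSeq Δ h)) x y =
      rk h x y - rk (removalSeq Δ h : Mult) x y + rk (truncations Δ.b (removalSeq Δ h)) x y := by
    intro x y
    rw [rk_add, rk_sub hle]
  have hsub : ∀ s ∈ h - (removalSeq Δ h : Mult) + truncations Δ.b (removalSeq Δ h),
      s ∈ h ∨ s ∈ truncations Δ.b (removalSeq Δ h) := by
    intro s hs
    rcases Multiset.mem_add.1 hs with hs | hs
    · exact Or.inl (Multiset.mem_of_le tsub_le_self hs)
    · exact Or.inr hs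
  have hΔle := Δ.le
  refine ⟨⟨?_, ?_, ?_⟩, ?_, ?_⟩
  · intro x y hxy
    rw [rk_singleton, hrk]
    have := C.rk_le x y hxy
    split_ifs with h1
    · have := C.rk_inner x y hxy (by omega) (by omega)
      omega
    · omega
  · intro x
    rw [rk_singleton, hrk]
    split_ifs with h1
    · have := C.rk_inner x x le_rfl (by omega) (by omega)
      omega
    · by_cases hx : x < p.a
      · have := C.rk_lt x x le_rfl hx
        omega
      · have := C.rk_gt x x le_rfl (by omega)
        omega
  · intro s hs
    have hsle := s.le
    rw [rk_singleton, hrk]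
    rcases hsub s hs with hs | hs
    · split_ifs with h1
      · have := C.rk_inner s.a (s.b + 1) (by omega) (by omega) (by omega)
        omega
      · rcases lt_trichotomy s.a p.a with h2 | h2 | h2
        · have := C.rk_lt s.a (s.b + 1) (by omega) h2
          omega
        · have := C.rk_far s.a (s.b + 1) (by omega)
            (by have := hmin s hs (by omega) (by omega); omega)
          omega
        · have := C.tight s hs h2 (by omega)
          omega
    · have := C.mem_trunc s hs
      have := C.tight_trunc s hs
      rw [if_neg (by omega)]
      omega
  · intro x y hxy hx
    rw [hrk, C.rk_lt x y hxy (by omega)]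
    omega
  · intro s hs
    refine (hsub s hs).imp_right fun hs => ?_
    obtain ⟨-, -, s', h1, h2, h3, h4⟩ := C.mem_trunc s hs
    exact ⟨s', h1, h2, by omega, h4⟩

/-! ### Row comparison of defects and uniqueness of the result -/

theorem row_le {f g : ℤ → ℤ} {x : ℤ} (hf : f x = 0) (hg : ∀ y, x ≤ y → 0 ≤ g y)
    (hstep : ∀ t, x ≤ t → 0 < f (t + 1) → f (t + 1) - f t ≤ g (t + 1) - g t) (y : ℤ)
    (hy : x ≤ y) : f y ≤ g y := by
  induction y, hy using Int.leInduction with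
  | base => rw [hf]; exact hg x le_rfl
  | succ t ht ih =>
    -- Where `f` is not positive, nonnegativity of `g` suffices, so increments matter only at
    -- positive defect.
    by_cases h : 0 < f (t + 1)
    · have := hstep t ht h
      omega
    · have := hg (t + 1) (by omega)
      omega

/-- The defect of the rank inequality for `(n, h, k)` at `(x, y)`. -/
def slack (n h k : Mult) (x y : ℤ) : ℤ := rk h x y - rk k x y - rk n x y

namespace IsRemoval

variable {n h k : Mult}

theorem slack_nonneg (H : IsRemoval n h k) {x y : ℤ} (hxy : x ≤ y) : 0 ≤ slack n h k x y := by
  have := H.le x y hxy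
  unfold slack; omega

theorem slack_self (H : IsRemoval n h k) (x : ℤ) : slack n h k x x = 0 := by
  have := H.diag x
  unfold slack; omega

theorem slack_tight (H : IsRemoval n h k) {s : Seg} (hs : s ∈ k) :
    slack n h k s.a (s.b + 1) = 0 := by
  have := H.tight s hs
  unfold slack; omega

/-- By tightness, a positive defect at `(x, t+1)` excludes `[x,t]` from `k`. -/
theorem rect_eq_zero (H : IsRemoval n h k) {x t : ℤ} (hx : 0 < slack n h k x (t + 1)) :
    rk k x t - rk k x (t + 1) - rk k (x - 1) t + rk k (x - 1) (t + 1) = 0 := by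
  refine Multisegment.rect_eq_zero (by omega) (by omega) fun s hs h => ?_
  have := H.slack_tight hs
  rw [show s.a = x by omega, show s.b = t by omega] at this
  omega

/-- Row comparison: the defect is monotone in the part of the row that lies in `n`. -/
theorem slack_le {n' k' : Mult} (H : IsRemoval n h k) (H' : IsRemoval n' h k') {x : ℤ}
    (hk : ∀ y, x ≤ y → rk k (x - 1) y = rk k' (x - 1) y)
    (hn : ∀ y, x ≤ y → rk n x y - rk n x (y + 1) ≤ rk n' x y - rk n' x (y + 1))
    {y : ℤ} (hy : x ≤ y) : slack n h k x y ≤ slack n' h k' x y := by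
  refine row_le (f := slack n h k x) (g := slack n' h k' x) (H.slack_self x)
    (fun y hy => H'.slack_nonneg hy) (fun t ht hpos => ?_) y hy
  have h1 := H.rect_eq_zero hpos
  have h2 := rect_nonneg k' (x₀ := x - 1) (x₁ := x) (y₀ := t) (y₁ := t + 1) (by omega) (by omega)
  have h3 := hk t ht
  have h4 := hk (t + 1) (by omega)
  have h5 := hn t ht
  unfold slack
  omega

/-- Between adjacent rows, where the defect is positive, only segments of `h` starting at `x`
contribute, and they only slow its growth. -/
theorem slack_le_pred (H : IsRemoval n h k) {x y : ℤ} (hn : ∀ s ∈ n, s.a ≠ x) (hy : x ≤ y) :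
    slack n h k x y ≤ slack n h k (x - 1) y := by
  refine row_le (f := slack n h k x) (g := slack n h k (x - 1)) (H.slack_self x)
    (fun y hy => H.slack_nonneg (by omega)) (fun t ht hpos => ?_) y hy
  have h1 := H.rect_eq_zero hpos
  have h2 := rect_nonneg h (x₀ := x - 1) (x₁ := x) (y₀ := t) (y₁ := t + 1) (by omega) (by omega)
  have h3 := Multisegment.rect_eq_zero (m := n) (x₀ := x - 1) (x₁ := x) (y₀ := t) (y₁ := t + 1)
    (by omega) (by omega) (fun s hs h => hn s hs (by omega))
  unfold slack
  omega

theorem slack_anti (H : IsRemoval n h k) {x x' y : ℤ} (hx : x ≤ x')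
    (hn : ∀ s ∈ n, s.a ≤ x) (hy : x' ≤ y) : slack n h k x' y ≤ slack n h k x y := by
  induction x', hx using Int.leInduction with
  | base => exact le_rfl
  | succ z hz ih =>
    have h1 := H.slack_le_pred (x := z + 1) (y := y)
      (fun s hs h => by have := hn s hs; omega) hy
    rw [add_sub_cancel_right] at h1
    exact h1.trans (ih (by omega))

/-- Each row of `k` is forced by the previous one, starting left of all segments. The cutoff `X`
allows `n` to be compared with an extension of it by later segments. -/
theorem rk_unique {n' k' : Mult} (H : IsRemoval n h k) (H' : IsRemoval n' h k') {X : ℤ}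
    (hn : ∀ x y, x ≤ X → x ≤ y → rk n x y = rk n' x y) {x y : ℤ} (hx : x ≤ X) (hxy : x ≤ y) :
    rk k x y = rk k' x y := by
  obtain ⟨x₀, hx₀⟩ := exists_lt_starts (k + k')
  have hlow : ∀ x y, x ≤ x₀ → rk k x y = rk k' x y := by
    intro x y hx
    rw [rk_eq_zero, rk_eq_zero]
    · intro s hs h
      have := hx₀ s (Multiset.mem_add.2 (Or.inr hs))
      omega
    · intro s hs h
      have := hx₀ s (Multiset.mem_add.2 (Or.inl hs))
      omega
  rcases le_total x x₀ with h | h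
  · exact hlow x y h
  induction x, h using Int.leInduction generalizing y with
  | base => exact hlow _ y le_rfl
  | succ z hz ih =>
    have hprev : ∀ y, z + 1 ≤ y → rk k (z + 1 - 1) y = rk k' (z + 1 - 1) y := by
      intro y hy
      rw [add_sub_cancel_right]
      exact ih (by omega) (by omega)
    have hn' : ∀ y, z + 1 ≤ y → rk n (z + 1) y = rk n' (z + 1) y := fun y hy => hn _ _ hx hy
    have h1 := H.slack_le H' hprev
      (fun y hy => by rw [hn' y hy, hn' (y + 1) (by omega)]) hxy
    have h2 := H'.slack_le H (fun y hy => (hprev y hy).symm)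
      (fun y hy => by rw [hn' y hy, hn' (y + 1) (by omega)]) hxy
    have h3 := hn' y hxy
    unfold slack at h1 h2
    omega

theorem unique {k' : Mult} (H : IsRemoval n h k) (H' : IsRemoval n h k') : k = k' :=
  rk_ext fun x _ hxy => H.rk_unique H' (X := x) (fun _ _ _ _ => rfl) le_rfl hxy

theorem zero (h : Mult) : IsRemoval 0 h h := ⟨by simp, by simp, by simp⟩

theorem slack_add {Δ : Seg} {k' : Mult} (x y : ℤ) :
    slack (n + {Δ}) h k' x y = slack n h k x y + slack {Δ} k k' x y := by
  unfold slack
  rw [rk_add]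
  omega

theorem of_slack (h1 : ∀ x y, x ≤ y → 0 ≤ slack n h k x y) (h2 : ∀ x, slack n h k x x = 0)
    (h3 : ∀ s ∈ k, slack n h k s.a (s.b + 1) = 0) : IsRemoval n h k := by
  unfold slack at h1 h2 h3
  refine ⟨fun x y hxy => ?_, fun x => ?_, fun s hs => ?_⟩
  · have := h1 x y hxy
    omega
  · have := h2 x
    omega
  · have := h3 s hs
    omega

/-- Defects add up, so only tightness of the old defect at new segments is at stake. A new segment
shares its end with an old one starting further left, and the defect decreases to the right once no
segment of `n` starts there. -/
theorem add_singleton {Δ : Seg} {k' : Mult} (H : IsRemoval n h k) (H' : IsRemoval {Δ} k k')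
    (hmem : ∀ s ∈ k', s ∈ k ∨ ∃ s' ∈ k, s'.b = s.b ∧ Δ.a ≤ s'.a ∧ s'.a < s.a)
    (hn : ∀ s ∈ n, s.a ≤ Δ.a) : IsRemoval (n + {Δ}) h k' := by
  refine of_slack (fun x y hxy => ?_) (fun x => ?_) (fun s hs => ?_)
  · rw [slack_add (k := k)]
    exact add_nonneg (H.slack_nonneg hxy) (H'.slack_nonneg hxy)
  · rw [slack_add (k := k), H.slack_self, H'.slack_self, add_zero]
  · rw [slack_add (k := k), H'.slack_tight hs, add_zero]
    rcases hmem s hs with hs' | ⟨s', hs', h1, h2, h3⟩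
    · exact H.slack_tight hs'
    · have hsle := s.le
      have h4 := H.slack_tight hs'
      rw [h1] at h4
      have h5 := H.slack_anti h3.le (fun t ht => (hn t ht).trans h2)
        (show s.a ≤ s.b + 1 by omega)
      exact le_antisymm (h4 ▸ h5) (H.slack_nonneg (by omega))

end IsRemoval

/-! ### The iterated process is equivalent to the rank conditions -/

theorem isRemoval_of_foldl {h : Mult} (l : List Seg) : ∀ {k : Mult},
    l.Pairwise (fun s t => s.a ≤ t.a) →
    l.foldl (fun x Δ => removal Δ x) (h : WithTop Mult) = (k : WithTop Mult) →
    IsRemoval l h k := by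
  induction l using List.reverseRecOn with
  | nil =>
    intro k _ hk
    obtain rfl : h = k := WithTop.coe_injective hk
    exact IsRemoval.zero h
  | append_singleton l Δ ih =>
    intro k hl hk
    rw [List.foldl_append, List.foldl_cons, List.foldl_nil] at hk
    rw [List.pairwise_append] at hl
    cases hk₀ : l.foldl (fun x Δ => removal Δ x) (h : WithTop Mult) with
    | top =>
      rw [hk₀] at hk
      exact absurd hk.symm (WithTop.coe_ne_top)
    | coe k₀ =>
      rw [hk₀] at hk
      have hadm : Admissible Δ k₀ := by
        by_contra hc
        rw [removal_eq_top hc] at hk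
        exact absurd hk.symm (WithTop.coe_ne_top)
      obtain ⟨k', h1, h2, -, h4⟩ := exists_removal hadm
      obtain rfl : k' = k := WithTop.coe_injective (h1.symm.trans hk)
      rw [← Multiset.coe_add, Multiset.coe_singleton]
      exact (ih hl.1 hk₀).add_singleton h2 h4 fun s hs => hl.2.2 s hs Δ (by simp)

theorem epsilon_eq_rk (Δ : Seg) (h : Mult) :
    (epsilon Δ h : ℤ) = rk h Δ.a Δ.b - rk h (Δ.a - 1) Δ.b := by
  unfold epsilon
  rw [← Multiset.countP_eq_card_filter]
  induction h using Multiset.induction with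
  | empty => simp
  | cons s m ih =>
    rw [Multiset.countP_cons, rk_cons, rk_cons]
    push_cast
    rw [ih]
    split_ifs <;> omega

theorem admissible_iff_epsilon {Δ : Seg} {h : Mult} : Admissible Δ h ↔ 0 < epsilon Δ h := by
  unfold epsilon Admissible
  rw [← Multiset.countP_eq_card_filter, Multiset.countP_pos]

/-- `k₀` and `k` agree in rows before `Δ.a`, and row comparison at `(Δ.a, Δ.b)` gives `rk k + rk m ≤
rk k₀`. So `k₀` has at least `rk m Δ.a Δ.b > 0` suitable segments starting at `Δ.a`. -/
theorem IsRemoval.admissible {n m h k₀ k : Mult} {Δ : Seg} (H₀ : IsRemoval n h k₀)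
    (H : IsRemoval (n + m) h k) (hΔ : Δ ∈ m) (hm : ∀ s ∈ m, Δ.a ≤ s.a) : Admissible Δ k₀ := by
  have hzero : ∀ x y, x < Δ.a → rk m x y = 0 := fun x y hx =>
    rk_eq_zero fun s hs h' => by have := hm s hs; omega
  have hrows : ∀ y, Δ.a - 1 ≤ y → rk k₀ (Δ.a - 1) y = rk k (Δ.a - 1) y := fun y hy =>
    H₀.rk_unique H (X := Δ.a - 1)
      (fun x y hx _ => by rw [rk_add, hzero x y (by omega), add_zero]) le_rfl hy
  have hΔle := Δ.le
  have h1 := H₀.slack_le H (x := Δ.a) (y := Δ.b) (fun y hy => hrows y (by omega))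
    (fun y hy => by
      have := rect_nonneg m (x₀ := Δ.a - 1) (x₁ := Δ.a) (y₀ := y) (y₁ := y + 1)
        (by omega) (by omega)
      have := hzero (Δ.a - 1) y (by omega)
      have := hzero (Δ.a - 1) (y + 1) (by omega)
      rw [rk_add, rk_add]
      omega) hΔle
  have h2 := hrows Δ.b (by omega)
  have h3 : 0 < rk m Δ.a Δ.b := rk_pos hΔ le_rfl le_rfl
  have h4 := rk_mono_left k (show Δ.a - 1 ≤ Δ.a by omega) Δ.b
  have h5 := epsilon_eq_rk Δ k₀
  rw [admissible_iff_epsilon]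
  unfold slack at h1
  rw [rk_add] at h1
  omega

theorem exists_foldl_of_isRemoval {h k : Mult} (l₀ : List Seg) : ∀ {l₁ : List Seg},
    (l₀ ++ l₁).Pairwise (fun s t => s.a ≤ t.a) → IsRemoval (l₀ ++ l₁ : List Seg) h k →
    ∃ k₀ : Mult, l₀.foldl (fun x Δ => removal Δ x) (h : WithTop Mult) = (k₀ : WithTop Mult) := by
  induction l₀ using List.reverseRecOn with
  | nil => intro _ _ _; exact ⟨h, rfl⟩
  | append_singleton l Δ ih =>
    intro l₁ hl H
    rw [List.append_assoc, List.singleton_append] at hl H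
    obtain ⟨k₀, hk₀⟩ := ih hl H
    have hl' := List.pairwise_append.1 hl
    rw [← Multiset.coe_add] at H
    have hadm : Admissible Δ k₀ := by
      refine (isRemoval_of_foldl l hl'.1 hk₀).admissible H (by simp) fun s hs => ?_
      rcases List.mem_cons.1 (Multiset.mem_coe.1 hs) with rfl | hs
      · exact le_rfl
      · exact List.rel_of_pairwise_cons hl'.2.1 hs
    obtain ⟨k', h1, -⟩ := exists_removal hadm
    exact ⟨k', by rw [List.foldl_append, hk₀, List.foldl_cons, List.foldl_nil, h1]⟩

theorem removalMult_eq_iff {n h k : Mult} :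
    removalMult n h = (k : WithTop Mult) ↔ IsRemoval n h k := by
  have hs : (n.sort (· ≤ ·)).Pairwise (fun s t => s.a ≤ t.a) := by
    refine (Multiset.pairwise_sort n (· ≤ ·)).imp fun {s t} hst => ?_
    rw [Seg.le_iff] at hst
    omega
  have fwd : ∀ {k : Mult}, removalMult n h = (k : WithTop Mult) → IsRemoval n h k := by
    intro k hk
    have := isRemoval_of_foldl _ hs hk
    rwa [Multiset.sort_eq] at this
  refine ⟨fwd, fun H => ?_⟩
  obtain ⟨k₀, hk₀⟩ : ∃ k₀ : Mult, removalMult n h = (k₀ : WithTop Mult) := by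
    refine exists_foldl_of_isRemoval (k := k) (l₁ := []) _ ?_ ?_
    · rwa [List.append_nil]
    · rwa [List.append_nil, Multiset.sort_eq]
  rw [hk₀, (fwd hk₀).unique H]

/-! ### Minimality -/

theorem ElemStep.rk_eq {m m' m₀ : Mult} {s t : Seg} (hst : s.Precedes t)
    (hm : m = m₀ + {s} + {t}) (hm' : m' = m₀ + ofEnds s.a t.b + ofEnds t.a s.b) {x y : ℤ}
    (hxy : x ≤ y) :
    rk m' x y = rk m x y + if (s.a ≤ x ∧ x < t.a) ∧ (s.b < y ∧ y ≤ t.b) then 1 else 0 := by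
  obtain ⟨h1, h2, h3⟩ := hst
  rw [hm, hm', rk_add, rk_add, rk_add, rk_add, rk_ofEnds _ _ hxy, rk_ofEnds _ _ hxy,
    rk_singleton, rk_singleton]
  split_ifs <;> omega

theorem ZLe.rk_le {m m' : Mult} (h : ZLe m' m) {x y : ℤ} (hxy : x ≤ y) :
    rk m x y ≤ rk m' x y := by
  induction h with
  | refl => exact le_rfl
  | tail _ hs ih =>
    obtain ⟨s, t, m₀, hst, hm, hm'⟩ := hs
    rw [ElemStep.rk_eq hst hm hm' hxy]
    split_ifs <;> omega

/-- `n` is minimal if and only if every elementary process on `n` violates a rank inequality. -/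
theorem minimalTo_iff {n h k : Mult} (H : IsRemoval n h k) :
    MinimalTo n h ↔ ∀ s ∈ n, ∀ t ∈ n, s.Precedes t →
      ∃ x y, (s.a ≤ x ∧ x < t.a) ∧ (s.b < y ∧ y ≤ t.b) ∧ slack n h k x y = 0 := by
  have hk := removalMult_eq_iff.2 H
  constructor
  · rintro ⟨-, hmin⟩ s hs t ht hst
    by_contra! hno
    have ⟨h1, h2, h3⟩ := hst
    have hsle := s.le
    have hne : s ≠ t := by
      rintro rfl
      omega
    have hn : n = (n.erase t).erase s + {s} + {t} := by
      rw [add_comm ((n.erase t).erase s) ({s} : Mult), Multiset.singleton_add,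
        Multiset.cons_erase ((Multiset.mem_erase_of_ne hne).2 hs), add_comm,
        Multiset.singleton_add, Multiset.cons_erase ht]
    obtain ⟨n', hn'⟩ : ∃ n', n' = (n.erase t).erase s + ofEnds s.a t.b + ofEnds t.a s.b :=
      ⟨_, rfl⟩
    have hrk := fun x y (hxy : x ≤ y) => ElemStep.rk_eq hst hn hn' hxy
    have H' : IsRemoval n' h k := by
      refine .of_slack (fun x y hxy => ?_) (fun x => ?_) (fun u hu => ?_)
      · have h4 := H.slack_nonneg hxy
        have h5 := hno x y
        have h6 := hrk x y hxy
        unfold slack at *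
        split_ifs at h6 with h7
        · have := h5 h7.1 h7.2
          omega
        · omega
      · have h4 := H.slack_self x
        have h6 := hrk x x le_rfl
        rw [if_neg (by omega)] at h6
        unfold slack at *
        omega
      · have h4 := H.slack_tight hu
        have hule := u.le
        have h6 := hrk u.a (u.b + 1) (by omega)
        -- The tight point is a zero of the defect, hence lies outside the zero-free rectangle and
        -- keeps its rank.
        rw [if_neg fun h7 => hno _ _ h7.1 h7.2 h4] at h6
        unfold slack at *
        omega
    have heq := hmin n' ((removalMult_eq_iff.2 H').trans hk.symm)
      (Relation.ReflTransGen.single ⟨s, t, _, hst, hn, hn'⟩)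
    have h4 := hrk s.a t.b (by omega)
    rw [heq, if_pos (by omega)] at h4
    omega
  · intro hz
    refine ⟨by rw [hk]; exact WithTop.coe_ne_top, fun n' hn' hle => ?_⟩
    have H' := removalMult_eq_iff.1 (hn'.trans hk)
    rcases Relation.ReflTransGen.cases_head hle with heq | ⟨n₁, ⟨s, t, m₀, hst, hm, hm'⟩, hle₁⟩
    · exact heq.symm
    · exfalso
      obtain ⟨x, y, hx, hy, hs⟩ := hz s (by simp [hm]) t (by simp [hm]) hst
      have ⟨h1, h2, h3⟩ := hst
      have hxy : x ≤ y := by omega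
      have h4 := ElemStep.rk_eq hst hm hm' hxy
      rw [if_pos ⟨hx, hy⟩] at h4
      -- Later processes never lower ranks, so the inequality broken at this zero by the first
      -- process stays broken.
      have h5 := ZLe.rk_le hle₁ hxy
      have h6 := H'.le x y hxy
      unfold slack at hs
      omega

/-! ### Zeros of the defect at the corner `(a-1, b)` and the invariant `η` -/

/-- If every segment of `n` ending between `x` and `b` sees a zero of the defect to its
upper right, up to row `x`, then the defect vanishes at `(x, b)`. -/
theorem IsRemoval.slack_eq_zero_of_rect {n h k : Mult} (H : IsRemoval n h k) {X b : ℤ}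
    (hX : X ≤ b)
    (hz : ∀ s ∈ n, s.a ≤ X → X ≤ s.b → s.b < b →
      ∃ x y, (s.a ≤ x ∧ x ≤ X) ∧ (s.b < y ∧ y ≤ b) ∧ slack n h k x y = 0) :
    slack n h k X b = 0 := by
  by_contra hne
  -- `β` is the last zero of row `X` up to column `b`, and `x₀` the last row up to `X` with a zero
  -- `y₀` in columns `(β, b]`. The rectangle `x₀ < a(s) ≤ X`, `β ≤ b(s) < y₀` then holds no segment
  -- of `k` or `n`, since either would yield a zero in a row beyond `x₀`. As `h` counts
  -- nonnegatively there, the defects at the four corners contradict each other.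
  obtain ⟨β, ⟨hβ1, hβ2, hβ3⟩, hβ⟩ := Int.exists_greatest_of_bdd
    (P := fun z => X ≤ z ∧ z ≤ b ∧ slack n h k X z = 0)
    ⟨b, fun z hz => hz.2.1⟩ ⟨X, le_rfl, hX, H.slack_self X⟩
  have hβb : β < b := lt_of_le_of_ne hβ2 fun h' => hne (h' ▸ hβ3)
  obtain ⟨x₀, ⟨hx1, y₀, ⟨hy1, hy2⟩, hy3⟩, hx₀⟩ := Int.exists_greatest_of_bdd
    (P := fun x => x ≤ X ∧ ∃ y, (β < y ∧ y ≤ b) ∧ slack n h k x y = 0)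
    ⟨X, fun z hz => hz.1⟩ (by
      -- Left of all starts every rank is zero, so such a row exists.
      obtain ⟨z, hz⟩ := exists_lt_starts (n + h + k)
      refine ⟨min z X, min_le_right _ _, b, ⟨hβb, le_rfl⟩, ?_⟩
      have hrk : ∀ m ≤ n + h + k, rk m (min z X) b = 0 := fun m hm =>
        rk_eq_zero fun s hs h' => by
          have := hz s (Multiset.mem_of_le hm hs)
          omega
      unfold slack
      rw [hrk h ((Multiset.le_add_left _ _).trans (Multiset.le_add_right _ _)),
        hrk k (Multiset.le_add_left _ _), hrk n (by
          rw [add_assoc]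
          exact Multiset.le_add_right _ _)]
      simp)
  have hxX : x₀ < X := by
    refine lt_of_le_of_ne hx1 ?_
    rintro rfl
    have := hβ y₀ ⟨by omega, hy2, hy3⟩
    omega
  have hXy : 0 < slack n h k X y₀ := by
    refine lt_of_le_of_ne (H.slack_nonneg (by omega)) fun h' => ?_
    have := hβ y₀ ⟨by omega, hy2, h'.symm⟩
    omega
  have hxβ := H.slack_nonneg (x := x₀) (y := β) (by omega)
  have hk := Multisegment.rect_eq_zero (m := k) (x₀ := x₀) (x₁ := X) (y₀ := β) (y₁ := y₀)
    hx1 hy1.le (fun s hs h' => by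
      have := hx₀ s.a ⟨h'.1.2, s.b + 1, ⟨by omega, by omega⟩, H.slack_tight hs⟩
      omega)
  have hh := rect_nonneg h (x₀ := x₀) (x₁ := X) (y₀ := β) (y₁ := y₀) hx1 hy1.le
  have hn := Multisegment.rect_eq_zero (m := n) (x₀ := x₀) (x₁ := X) (y₀ := β) (y₁ := y₀)
    hx1 hy1.le (fun s hs h' => by
      obtain ⟨x, y, h1, h2, h3⟩ := hz s hs h'.1.2 (by omega) (by omega)
      have := hx₀ x ⟨h1.2, y, ⟨by omega, h2.2⟩, h3⟩
      omega)
  unfold slack at hXy hxβ hβ3 hy3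
  omega

theorem IsRemoval.eta_eq_iff {n h k : Mult} {Δ : Seg} (H : IsRemoval n h k)
    (hΔ : ∀ s ∈ n, s.a < Δ.a ∧ s.b < Δ.b) :
    eta Δ k = eta Δ h ↔ slack n h k (Δ.a - 1) Δ.b = 0 := by
  have hΔle := Δ.le
  have hn : ∀ x, rk n x Δ.b = 0 := fun x => rk_eq_zero fun s hs _ => (hΔ s hs).2
  have heps : ∀ c (hc : c ≤ Δ.b), (epsilon ⟨c, Δ.b, hc⟩ h : ℤ) - epsilon ⟨c, Δ.b, hc⟩ k =
      slack n h k c Δ.b - slack n h k (c - 1) Δ.b := by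
    intro c hc
    rw [epsilon_eq_rk, epsilon_eq_rk]
    unfold slack
    rw [hn, hn]
    ring
  constructor
  · intro he
    have hconst : ∀ c, Δ.a - 1 ≤ c → c ≤ Δ.b →
        slack n h k c Δ.b = slack n h k (Δ.a - 1) Δ.b := by
      intro c hc
      induction c, hc using Int.leInduction with
      | base => exact fun _ => rfl
      | succ c hc ih =>
        intro hcb
        have h1 : epsilon ⟨c + 1, Δ.b, hcb⟩ k = epsilon ⟨c + 1, Δ.b, hcb⟩ h :=
          congrFun he ⟨c + 1, by omega, hcb⟩
        have h2 := heps (c + 1) hcb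
        rw [h1, sub_self, add_sub_cancel_right] at h2
        have h3 := ih (by omega)
        omega
    -- The constant value along column `Δ.b` is the diagonal one, which is zero.
    rw [← hconst Δ.b (by omega) le_rfl, H.slack_self]
  · intro h0
    have hzero : ∀ c, Δ.a - 1 ≤ c → c ≤ Δ.b → slack n h k c Δ.b = 0 := by
      intro c hc hcb
      refine le_antisymm (h0 ▸ H.slack_anti hc (fun s hs => ?_) hcb) (H.slack_nonneg hcb)
      have := (hΔ s hs).1
      omega
    funext c
    have h1 := heps c c.2.2
    have h2 := c.2.1
    rw [hzero c (by omega) c.2.2, hzero (c - 1) (by omega) (by have := c.2.2; omega)] at h1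
    change epsilon ⟨c, Δ.b, c.2.2⟩ k = epsilon ⟨c, Δ.b, c.2.2⟩ h
    omega

theorem minimalTo_add_singleton_iff {n h k : Mult} {Δ : Seg} (H : IsRemoval n h k)
    (hn : MinimalTo n h) (hΔ : ∀ s ∈ n, s.a < Δ.a ∧ s.b < Δ.b) (hadm : Admissible Δ k) :
    MinimalTo (n + {Δ}) h ↔ slack n h k (Δ.a - 1) Δ.b = 0 := by
  obtain ⟨k', -, h1, h2, h3⟩ := exists_removal hadm
  have H' := H.add_singleton h1 h3 fun s hs => (hΔ s hs).1.le
  have hslack : ∀ x y, x ≤ y → x < Δ.a → slack (n + {Δ}) h k' x y = slack n h k x y := by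
    intro x y hxy hx
    unfold slack
    rw [rk_add, h2 x y hxy hx, rk_singleton, if_neg (by omega), add_zero]
  have hΔle := Δ.le
  rw [minimalTo_iff H']
  constructor
  · intro hz
    -- With `X = Δ.a - 1`, the condition `X ≤ s.b` is exactly the linking condition `Δ.a ≤ s.b + 1`.
    refine H.slack_eq_zero_of_rect (by omega) fun s hs h4 h5 h6 => ?_
    obtain ⟨x, y, hx, hy, hxy⟩ := hz s (by simp [hs]) Δ (by simp)
      ⟨by omega, by omega, by omega⟩
    rw [hslack x y (by omega) hx.2] at hxy
    exact ⟨x, y, ⟨hx.1, by omega⟩, hy, hxy⟩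
  · intro h0 s hs t ht hst
    have ⟨h4, h5, h6⟩ := hst
    rw [Multiset.mem_add, Multiset.mem_singleton] at hs ht
    have hs' : s ∈ n := by
      refine hs.resolve_right ?_
      rintro rfl
      rcases ht with ht | rfl
      · have := (hΔ t ht).1
        omega
      · omega
    rcases ht with ht | rfl
    · obtain ⟨x, y, hx, hy, hxy⟩ := (minimalTo_iff H).1 hn s hs' t ht hst
      have := (hΔ t ht).1
      exact ⟨x, y, hx, hy, by rw [hslack x y (by omega) (by omega), hxy]⟩
    · exact ⟨t.a - 1, t.b, ⟨by omega, by omega⟩, ⟨by omega, le_rfl⟩, by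
        rw [hslack _ _ (by omega) (by omega), h0]⟩

end Multisegment

theorem mainTheorem6 (h n k : Multisegment.Mult) (Δ : Multisegment.Seg)
    (hn : Multisegment.MinimalTo n h)
    (hΔ : ∀ Δ' ∈ n, Δ'.a < Δ.a ∧ Δ'.b < Δ.b)
    (hk : Multisegment.removalMult n h = (k : WithTop Multisegment.Mult)) :
    Multisegment.MinimalTo (n + {Δ}) h ↔
      (Multisegment.Admissible Δ h ∧ Multisegment.eta Δ k = Multisegment.eta Δ h) := by
  have H := Multisegment.removalMult_eq_iff.1 hk
  have hiff : Multisegment.eta Δ k = Multisegment.eta Δ h →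
      (Multisegment.Admissible Δ k ↔ Multisegment.Admissible Δ h) := by
    intro he
    -- The first entry of `η_Δ` is `ε_Δ`, whose positivity is admissibility.
    have h1 : Multisegment.epsilon Δ k = Multisegment.epsilon Δ h :=
      congrFun he ⟨Δ.a, le_rfl, Δ.le⟩
    rw [Multisegment.admissible_iff_epsilon, Multisegment.admissible_iff_epsilon, h1]
  constructor
  · intro hmin
    obtain ⟨k', hk'⟩ := WithTop.ne_top_iff_exists.1 hmin.1
    have hadm : Multisegment.Admissible Δ k :=
      H.admissible (Multisegment.removalMult_eq_iff.1 hk'.symm) (Multiset.mem_singleton_self Δ)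
        fun s hs => by rw [Multiset.mem_singleton.1 hs]
    have he := (H.eta_eq_iff hΔ).2
      ((Multisegment.minimalTo_add_singleton_iff H hn hΔ hadm).1 hmin)
    exact ⟨(hiff he).1 hadm, he⟩
  · rintro ⟨hadm, he⟩
    exact (Multisegment.minimalTo_add_singleton_iff H hn hΔ ((hiff he).2 hadm)).2
      ((H.eta_eq_iff hΔ).1 he)
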